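/- Let $k,p\ge 0$ and $m_1,\dots,m_k\ge 0$ be integers. For each $i\in\{1,\dots,k\}$ let $x_{i,1},x_{i,2},\dots$ be a sequence of (non-random) vectors in $\mathbb R^{m_i}$ and, for each sample size $n$, let $X_i=X_i^{(n)}$ be the $n\times m_i$ design matrix with rows $x_{i,1}',\dots,x_{i,n}'$; thus, when $n$ increases by one, a new row is added to $X_i$ and the earlier rows remain intact. Let $\mathcal E_1,\mathcal E_2,\dots$ be independent and identically distributed random vectors in $\mathbb R^p$ with $\mathrm E\|\mathcal E_1\|^2<\infty$, mean $\mathrm E(\mathcal E_1)=\mathbf 0$ and covariance matrix $\Sigma$, and let $\mathcal E=\mathcal E^{(n)}$ be the $n\times p$ random matrix with rows $\mathcal E_1',\dots,\mathcal E_n'$. Suppose that, for every $l\in\{1,\dots,k\}$, $$\lim_{n\to\infty} n^{-1}X_l'X_l=R_l ,$$ where $R_l$ is positive definite. Then, for every $i\in\{1,\dots,k\}$, with $S_i=(X_i'X_i)^{-1}X_i'$ (which is defined for all sufficiently large $n$), the random $m_i\times p$ matrix $\sqrt n\,S_i\mathcal E$ converges in distribution, as $n\to\infty$, to $\mathcal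 N_{m_i\times p}(\mathbf 0,R_i^{-1}\otimes\Sigma)$. Here $A\otimes B=(a_{ij}B)$ is the Kronecker product, and $\mathcal N_{m\times p}(\mathbf 0,V)$ denotes the law of a random $m\times p$ matrix $W$ for which $\operatorname{vec}(W)\in\mathbb R^{mp}$, obtained by stacking the rows of $W$ one underneath another, is multivariate normal with mean $\mathbf 0$ and covariance matrix $V$. -/

import Mathlib

open MeasureTheory ProbabilityTheory Filter Topology
open scoped Matrix Kronecker

/-- Real matrices carry the product (entrywise) sigma-algebra. -/
instance matrixMeasurableSpace {ι κ : Type*} : MeasurableSpace (Matrix ι κ ℝ) :=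
  inferInstanceAs (MeasurableSpace (ι → κ → ℝ))

/-- For finite index types, the entrywise sigma-algebra is the Borel sigma-algebra. -/
instance matrixBorelSpace {ι κ : Type*} [Fintype ι] [Fintype κ] : BorelSpace (Matrix ι κ ℝ) :=
  inferInstanceAs (BorelSpace (ι → κ → ℝ))

/-- The `n × m` design matrix available at sample size `n`: the first `n` rows of the sequence
`x`. Increasing `n` appends a row and leaves the earlier rows unchanged. -/
def designMatrix {κ : Type*} (x : ℕ → κ → ℝ) (n : ℕ) : Matrix (Fin n) κ ℝ :=
  Matrix.of fun j a => x j a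

/-- The `n × p` random error matrix at sample size `n`: its rows are the first `n` terms of the
sequence of random vectors `ε`. -/
def errorMatrix {Ω κ : Type*} (ε : ℕ → Ω → κ → ℝ) (n : ℕ) (ω : Ω) : Matrix (Fin n) κ ℝ :=
  Matrix.of fun j a => ε j ω a

/-- The matrix `S = (X'X)⁻¹ X'`. -/
noncomputable def olsMatrix {ι κ : Type*} [Fintype ι] [Fintype κ] [DecidableEq κ]
    (X : Matrix ι κ ℝ) : Matrix κ ι ℝ :=
  (Xᵀ * X)⁻¹ * Xᵀ

/-- The vectorization of a matrix that stacks its rows: the entry `(i, a)` of the matrix is the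
coordinate `(i, a)` of the vector, as in the Kronecker product
`(A ⊗ₖ B) (i, a) (j, b) = A i j * B a b`. -/
def rowVec {ι κ : Type*} (M : Matrix ι κ ℝ) : EuclideanSpace ℝ (ι × κ) :=
  WithLp.toLp 2 fun q => M q.1 q.2

/-- The inverse of `rowVec`. -/
def unRowVec {ι κ : Type*} (v : EuclideanSpace ℝ (ι × κ)) : Matrix ι κ ℝ :=
  Matrix.of fun i a => v (i, a)

lemma unRowVec_rowVec {ι κ : Type*} (M : Matrix ι κ ℝ) : unRowVec (rowVec M) = M := rfl

lemma rowVec_unRowVec {ι κ : Type*} (v : EuclideanSpace ℝ (ι × κ)) :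
    rowVec (unRowVec v) = v := rfl

lemma measurable_unRowVec {ι κ : Type*} [Fintype ι] [Fintype κ] :
    Measurable (unRowVec : EuclideanSpace ℝ (ι × κ) → Matrix ι κ ℝ) := by
  refine measurable_pi_lambda _ fun i => measurable_pi_lambda _ fun a => ?_
  change Measurable fun v : EuclideanSpace ℝ (ι × κ) => v (i, a)
  fun_prop

/-- The matrix normal law `N(M, V)`: the law of a random matrix whose row-stacking vectorization is
multivariate normal with mean `rowVec M` and covariance matrix `V`. -/
noncomputable def matrixNormal {ι κ : Type*} [Fintype ι] [Fintype κ] [DecidableEq ι]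
    [DecidableEq κ] (M : Matrix ι κ ℝ) (V : Matrix (ι × κ) (ι × κ) ℝ) :
    Measure (Matrix ι κ ℝ) :=
  (multivariateGaussian (rowVec M) V).map unRowVec

instance isProbabilityMeasure_matrixNormal {ι κ : Type*} [Fintype ι] [Fintype κ] [DecidableEq ι]
    [DecidableEq κ] (M : Matrix ι κ ℝ) (V : Matrix (ι × κ) (ι × κ) ℝ) :
    IsProbabilityMeasure (matrixNormal M V) :=
  Measure.isProbabilityMeasure_map measurable_unRowVec.aemeasurable

/-! ### Second order expansion of the complex exponential -/

/-! By Lévy's continuity theorem it suffices to follow the characteristic function of the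
row-stacked matrix at each `t`. Write `T` for `t` reshaped as a matrix. Pairing `√n S E` with `T`
gives a scalar sum `∑ j, w n j ⬝ᵥ ε j`, whose weights are the rows of `W = √n SᵀT = n^(-1/2) X A⁻¹
T`, with `A = XᵀX / n` (`inner_rowVec_olsMatrix_mul`, `olsWeights_eq`).

Independence turns the characteristic function into a product of factors `φ (w n j)`. Each factor
differs from the Gaussian one by `o(‖w n j‖²)`, and all factors lie in the unit disc, so the two
products differ by `o(1)` once the weights are uniformly small with bounded sum of squares
(`tendsto_charFun_sum_dotProduct`).

Everything about the weights follows from `A → R`. Since `WᵀW = TᵀA⁻¹T`, the Gaussian exponent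
converges to the quadratic form of `R⁻¹ ⊗ₖ Sig`. Convergence of the averages of `x j ⬝ᵥ x j` forces
`max_{j<n} (x j ⬝ᵥ x j) / n → 0`, because the rows come from one fixed sequence; this makes the
weights uniformly small. -/

lemma norm_exp_mul_I_sub_taylor_le_cube {x : ℝ} (hx : |x| ≤ 1) :
    ‖Complex.exp (x * Complex.I) - (1 + x * Complex.I - x ^ 2 / 2)‖ ≤ |x| ^ 3 := by
  have hn : ‖(x * Complex.I : ℂ)‖ = |x| := by simp
  have h := Complex.exp_bound (x := x * Complex.I) (by rwa [hn]) (n := 3) (by norm_num)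
  rw [hn] at h
  have e : ∑ m ∈ Finset.range 3, (x * Complex.I : ℂ) ^ m / (m.factorial : ℂ)
      = 1 + x * Complex.I - x ^ 2 / 2 := by
    simp [Finset.sum_range_succ, mul_pow, Nat.factorial]
    ring
  rw [e] at h
  refine h.trans (mul_le_of_le_one_right (by positivity) ?_)
  norm_num [Nat.factorial]

/-- Being global and quadratic, this bound supplies an integrable dominating function under a second
moment alone; the cubic bound supplies the pointwise limit. -/
lemma norm_exp_mul_I_sub_taylor_le_sq (x : ℝ) :
    ‖Complex.exp (x * Complex.I) - (1 + x * Complex.I - x ^ 2 / 2)‖ ≤ 4 * x ^ 2 := by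
  rcases le_total |x| 1 with hx | hx
  · refine (norm_exp_mul_I_sub_taylor_le_cube hx).trans ?_
    rw [← sq_abs x]
    nlinarith [abs_nonneg x, sq_nonneg |x|]
  · have h1 : ‖Complex.exp (x * Complex.I)‖ = 1 := Complex.norm_exp_ofReal_mul_I x
    have h2 : ‖(1 + x * Complex.I - x ^ 2 / 2 : ℂ)‖ ≤ 1 + |x| + |x| ^ 2 / 2 := by
      refine (norm_sub_le _ _).trans (add_le_add ((norm_add_le _ _).trans ?_) ?_) <;> simp
    refine (norm_sub_le _ _).trans ?_
    rw [h1, ← sq_abs x]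
    nlinarith

lemma norm_exp_neg_sub_one_sub_le {q : ℝ} (hq : 0 ≤ q) (hq1 : q ≤ 1) :
    ‖Complex.exp (-q) - (1 - q)‖ ≤ q ^ 2 := by
  have hn : ‖(-q : ℂ)‖ = q := by simp [abs_of_nonneg hq]
  have h := Complex.exp_bound (x := -q) (by rwa [hn]) (n := 2) (by norm_num)
  rw [hn] at h
  have e : ∑ m ∈ Finset.range 2, (-q : ℂ) ^ m / (m.factorial : ℂ) = 1 - q := by
    simp [Finset.sum_range_succ]
    ring
  rw [e] at h
  refine h.trans (mul_le_of_le_one_right (by positivity) ?_)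
  norm_num [Nat.factorial]

/-- Replace the factors one at a time: each exchange costs one difference, since the remaining
factors have norm at most one. -/
lemma norm_prod_sub_prod_le_sum {ι : Type*} (s : Finset ι) (f g : ι → ℂ)
    (hf : ∀ i ∈ s, ‖f i‖ ≤ 1) (hg : ∀ i ∈ s, ‖g i‖ ≤ 1) :
    ‖∏ i ∈ s, f i - ∏ i ∈ s, g i‖ ≤ ∑ i ∈ s, ‖f i - g i‖ := by
  classical
  induction s using Finset.induction_on with
  | empty => simp
  | insert a s ha ih =>
    rw [Finset.prod_insert ha, Finset.prod_insert ha, Finset.sum_insert ha]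
    have ih' := ih (fun i hi => hf i (Finset.mem_insert_of_mem hi))
      (fun i hi => hg i (Finset.mem_insert_of_mem hi))
    have hp : ‖∏ i ∈ s, f i‖ ≤ 1 := by
      rw [norm_prod]
      exact Finset.prod_le_one (fun _ _ => norm_nonneg _)
        fun i hi => hf i (Finset.mem_insert_of_mem hi)
    have hga := hg a (Finset.mem_insert_self a s)
    calc ‖f a * ∏ i ∈ s, f i - g a * ∏ i ∈ s, g i‖
        = ‖(f a - g a) * ∏ i ∈ s, f i + g a * (∏ i ∈ s, f i - ∏ i ∈ s, g i)‖ := by ring_nf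
      _ ≤ ‖f a - g a‖ * ‖∏ i ∈ s, f i‖ + ‖g a‖ * ‖∏ i ∈ s, f i - ∏ i ∈ s, g i‖ := by
        refine (norm_add_le _ _).trans ?_
        rw [norm_mul, norm_mul]
      _ ≤ ‖f a - g a‖ * 1 + 1 * ‖∏ i ∈ s, f i - ∏ i ∈ s, g i‖ := by gcongr
      _ ≤ _ := by linarith

/-! ### Random vectors with finite second moments -/

section RandomVector

variable {Ω κ : Type*} [MeasurableSpace Ω] [Fintype κ] {P : Measure Ω}

lemma memLp_dotProduct {X : Ω → κ → ℝ} (hX : ∀ a, MemLp (fun ω => X ω a) 2 P) (w : κ → ℝ) :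
    MemLp (fun ω => w ⬝ᵥ X ω) 2 P := by
  unfold dotProduct
  exact memLp_finsetSum _ fun a _ => (hX a).const_mul (w a)

/-- Hölder's inequality: the norm on `κ → ℝ` is the sup norm, so it pairs with the `ℓ¹` norm. -/
lemma abs_dotProduct_le_norm_mul_sum (w v : κ → ℝ) : |w ⬝ᵥ v| ≤ ‖w‖ * ∑ a, |v a| := by
  unfold dotProduct
  refine (Finset.abs_sum_le_sum_abs _ _).trans ?_
  rw [Finset.mul_sum]
  refine Finset.sum_le_sum fun a _ => ?_
  rw [abs_mul]
  gcongr
  exact norm_le_pi_norm w a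

variable [IsProbabilityMeasure P] {X : Ω → κ → ℝ} {Sig : Matrix κ κ ℝ}

lemma integral_dotProduct_eq_zero (hX : ∀ a, MemLp (fun ω => X ω a) 2 P)
    (hmean : ∀ a, ∫ ω, X ω a ∂P = 0) (w : κ → ℝ) : ∫ ω, w ⬝ᵥ X ω ∂P = 0 := by
  unfold dotProduct
  rw [integral_finsetSum _ fun a _ => ((hX a).integrable one_le_two).const_mul _]
  simp [integral_const_mul, hmean]

lemma variance_dotProduct (hX : ∀ a, MemLp (fun ω => X ω a) 2 P)
    (hcov : ∀ a b, cov[fun ω => X ω a, fun ω => X ω b; P] = Sig a b) (w : κ → ℝ) :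
    Var[fun ω => w ⬝ᵥ X ω; P] = w ⬝ᵥ Sig *ᵥ w := by
  rw [← covariance_self (memLp_dotProduct hX w).aemeasurable]
  unfold dotProduct Matrix.mulVec
  rw [covariance_fun_sum_fun_sum (fun a => (hX a).const_mul _) (fun a => (hX a).const_mul _)]
  refine Finset.sum_congr rfl fun a _ => ?_
  unfold dotProduct
  rw [Finset.mul_sum]
  refine Finset.sum_congr rfl fun b _ => ?_
  rw [covariance_const_mul_left, covariance_const_mul_right, hcov]
  ring

lemma integral_dotProduct_sq (hX : ∀ a, MemLp (fun ω => X ω a) 2 P)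
    (hmean : ∀ a, ∫ ω, X ω a ∂P = 0)
    (hcov : ∀ a b, cov[fun ω => X ω a, fun ω => X ω b; P] = Sig a b) (w : κ → ℝ) :
    ∫ ω, (w ⬝ᵥ X ω) ^ 2 ∂P = w ⬝ᵥ Sig *ᵥ w := by
  rw [← variance_dotProduct hX hcov,
    variance_of_integral_eq_zero (memLp_dotProduct hX w).aemeasurable
      (integral_dotProduct_eq_zero hX hmean w)]

/-- The quadratic form of `Sig` at `w` is the variance of `w ⬝ᵥ X`. Positivity keeps the Gaussian
factors in the unit disc. -/
lemma posSemidef_of_covariance_eq (hX : ∀ a, MemLp (fun ω => X ω a) 2 P)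
    (hcov : ∀ a b, cov[fun ω => X ω a, fun ω => X ω b; P] = Sig a b) : Sig.PosSemidef := by
  refine .of_dotProduct_mulVec_nonneg ?_ fun w => ?_
  · ext a b
    simp [← hcov, covariance_comm]
  · simpa [variance_dotProduct hX hcov w] using variance_nonneg (fun ω => w ⬝ᵥ X ω) P

/-- Uniform second order expansion at the origin of the characteristic function of a centred
random vector with finite second moments. -/
lemma integral_exp_dotProduct_isLittleO (hX : ∀ a, MemLp (fun ω => X ω a) 2 P)
    (hmean : ∀ a, ∫ ω, X ω a ∂P = 0)
    (hcov : ∀ a b, cov[fun ω => X ω a, fun ω => X ω b; P] = Sig a b) :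
    (fun w : κ → ℝ => ∫ ω, Complex.exp ((w ⬝ᵥ X ω : ℝ) * Complex.I) ∂P
      - (1 - ((w ⬝ᵥ Sig *ᵥ w : ℝ) : ℂ) / 2)) =o[𝓝 0] fun w => ‖w‖ ^ 2 := by
  set r : ℝ → ℂ := fun x => Complex.exp (x * Complex.I) - (1 + x * Complex.I - x ^ 2 / 2) with hr
  have hrc : Continuous r := by fun_prop
  have hm (w : κ → ℝ) : AEStronglyMeasurable (fun ω => w ⬝ᵥ X ω) P :=
    (memLp_dotProduct hX w).aestronglyMeasurable
  -- The linear Taylor term integrates to zero by centring and the quadratic one to the form of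
  -- `Sig`, leaving only the remainder `r`.
  have hI (w : κ → ℝ) : ∫ ω, Complex.exp ((w ⬝ᵥ X ω : ℝ) * Complex.I) ∂P
      - (1 - ((w ⬝ᵥ Sig *ᵥ w : ℝ) : ℂ) / 2) = ∫ ω, r (w ⬝ᵥ X ω) ∂P := by
    have i1 : Integrable (fun ω => Complex.exp ((w ⬝ᵥ X ω : ℝ) * Complex.I)) P := by
      refine Integrable.of_bound (C := 1) ?_ (ae_of_all _ fun ω => ?_)
      · exact (by fun_prop : Continuous fun x : ℝ =>
          Complex.exp (x * Complex.I)).comp_aestronglyMeasurable (hm w)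
      · exact (Complex.norm_exp_ofReal_mul_I _).le
    have i2 : Integrable (fun ω => ((w ⬝ᵥ X ω : ℝ) : ℂ) * Complex.I) P :=
      (((memLp_dotProduct hX w).integrable one_le_two).ofReal).mul_const _
    have i3 : Integrable (fun ω => ((w ⬝ᵥ X ω : ℝ) : ℂ) ^ 2 / 2) P := by
      have := ((memLp_dotProduct hX w).integrable_sq).ofReal (𝕜 := ℂ)
      simpa using this.div_const 2
    have i12 : Integrable (fun ω => 1 + ((w ⬝ᵥ X ω : ℝ) : ℂ) * Complex.I) P :=
      (integrable_const _).add i2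
    simp only [hr]
    have i4 : Integrable (fun ω => 1 + ((w ⬝ᵥ X ω : ℝ) : ℂ) * Complex.I
        - ((w ⬝ᵥ X ω : ℝ) : ℂ) ^ 2 / 2) P := i12.sub i3
    rw [integral_sub i1 i4, integral_sub i12 i3,
      integral_add (integrable_const _) i2, integral_mul_const, integral_div]
    simp_rw [← Complex.ofReal_pow]
    rw [integral_complex_ofReal, integral_complex_ofReal, integral_dotProduct_eq_zero hX hmean,
      integral_dotProduct_sq hX hmean hcov]
    simp
  simp_rw [hI]
  have hle (w : κ → ℝ) (ω : Ω) : (w ⬝ᵥ X ω) ^ 2 ≤ ‖w‖ ^ 2 * (∑ a, |X ω a|) ^ 2 := by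
    rw [← mul_pow, ← sq_abs]
    exact pow_le_pow_left₀ (abs_nonneg _) (abs_dotProduct_le_norm_mul_sum w (X ω)) 2
  have hlim : Tendsto (fun w : κ → ℝ => ∫ ω, (((‖w‖ ^ 2)⁻¹ : ℝ) : ℂ) * r (w ⬝ᵥ X ω) ∂P)
      (𝓝 0) (𝓝 (∫ _, (0 : ℂ) ∂P)) := by
    refine tendsto_integral_filter_of_dominated_convergence
      (fun ω => 4 * (∑ a, |X ω a|) ^ 2) ?_ ?_ ?_ ?_
    · exact .of_forall fun w => (hrc.comp_aestronglyMeasurable (hm w)).const_mul _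
    · refine .of_forall fun w => ae_of_all _ fun ω => ?_
      rw [norm_mul, Complex.norm_real, Real.norm_of_nonneg (by positivity)]
      -- At `w = 0` the factor `(‖w‖ ^ 2)⁻¹` is `0` by convention.
      rcases eq_or_ne w 0 with rfl | hw
      · simp only [norm_zero]
        norm_num
        positivity
      · have : 0 < ‖w‖ ^ 2 := by positivity
        rw [inv_mul_le_iff₀ this]
        calc _ ≤ _ := norm_exp_mul_I_sub_taylor_le_sq _
          _ ≤ 4 * (‖w‖ ^ 2 * (∑ a, |X ω a|) ^ 2) := by gcongr; exact hle w ω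
          _ = _ := by ring
    · exact (memLp_finsetSum (f := fun a ω => |X ω a|) _
        fun a _ => (hX a).abs).integrable_sq.const_mul 4
    · refine ae_of_all _ fun ω => ?_
      -- For fixed `ω` and small `w`, the cubic bound divided by `‖w‖ ^ 2` leaves `‖w‖ * Y ^ 3`,
      -- which tends to zero.
      set Y := ∑ a, |X ω a| with hY
      have hY0 : 0 ≤ Y := by positivity
      rw [tendsto_zero_iff_norm_tendsto_zero]
      have hb : Tendsto (fun w : κ → ℝ => ‖w‖ * Y ^ 3) (𝓝 0) (𝓝 0) := by
        have : Continuous fun w : κ → ℝ => ‖w‖ * Y ^ 3 := by fun_prop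
        simpa using this.tendsto 0
      have hsmall : ∀ᶠ w : κ → ℝ in 𝓝 0, ‖w‖ * Y ≤ 1 := by
        have : Continuous fun w : κ → ℝ => ‖w‖ * Y := by fun_prop
        have h0 := this.tendsto 0
        simp only [norm_zero, zero_mul] at h0
        exact (h0.eventually_lt_const one_pos).mono fun _ h => h.le
      refine tendsto_of_tendsto_of_tendsto_of_le_of_le' tendsto_const_nhds hb
        (.of_forall fun _ => norm_nonneg _) ?_
      filter_upwards [hsmall] with w hw
      have hd := abs_dotProduct_le_norm_mul_sum w (X ω)
      rw [norm_mul, Complex.norm_real, Real.norm_of_nonneg (by positivity)]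
      rcases eq_or_ne w 0 with rfl | hw0
      · simp
      · have hpos : 0 < ‖w‖ ^ 2 := by positivity
        rw [inv_mul_le_iff₀ hpos]
        calc _ ≤ _ := norm_exp_mul_I_sub_taylor_le_cube (hd.trans hw)
          _ ≤ (‖w‖ * Y) ^ 3 := by gcongr
          _ = _ := by ring
  rw [integral_zero] at hlim
  simp_rw [integral_const_mul] at hlim
  rw [← Asymptotics.isLittleO_norm_left, Asymptotics.isLittleO_iff_tendsto]
  · have := hlim.norm
    rw [norm_zero] at this
    refine this.congr fun w => ?_
    rw [norm_mul, Complex.norm_real, Real.norm_of_nonneg (by positivity)]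
    field_simp
  · intro w hw
    have hw0 : w = 0 := by simpa using hw
    simp [hw0, hr]

lemma dotProduct_mulVec_isBigO (Sig : Matrix κ κ ℝ) :
    (fun w : κ → ℝ => w ⬝ᵥ Sig *ᵥ w) =O[𝓝 0] fun w => ‖w‖ ^ 2 := by
  refine Asymptotics.IsBigO.of_bound (∑ a, ∑ b, |Sig a b|) (.of_forall fun w => ?_)
  have h : ∑ a, |(Sig *ᵥ w) a| ≤ (∑ a, ∑ b, |Sig a b|) * ‖w‖ := by
    rw [Finset.sum_mul]
    refine Finset.sum_le_sum fun a _ => ?_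
    unfold Matrix.mulVec
    rw [dotProduct_comm]
    exact (abs_dotProduct_le_norm_mul_sum _ _).trans (mul_comm _ _).le
  rw [Real.norm_eq_abs, Real.norm_of_nonneg (by positivity)]
  refine (abs_dotProduct_le_norm_mul_sum _ _).trans ?_
  nlinarith [mul_le_mul_of_nonneg_left h (norm_nonneg w)]

/-- Near the origin, the characteristic function of a centred random vector is approximated, to
second order, by that of the Gaussian vector with the same covariance matrix. -/
lemma integral_exp_dotProduct_sub_exp_isLittleO (hX : ∀ a, MemLp (fun ω => X ω a) 2 P)
    (hmean : ∀ a, ∫ ω, X ω a ∂P = 0)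
    (hcov : ∀ a b, cov[fun ω => X ω a, fun ω => X ω b; P] = Sig a b) :
    (fun w : κ → ℝ => ∫ ω, Complex.exp ((w ⬝ᵥ X ω : ℝ) * Complex.I) ∂P
      - Complex.exp (-(((w ⬝ᵥ Sig *ᵥ w) / 2 : ℝ) : ℂ))) =o[𝓝 0] fun w => ‖w‖ ^ 2 := by
  have hpsd := posSemidef_of_covariance_eq hX hcov
  have hq0 (w : κ → ℝ) : 0 ≤ (w ⬝ᵥ Sig *ᵥ w) / 2 := by
    have := hpsd.dotProduct_mulVec_nonneg w
    simp only [star_trivial] at this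
    positivity
  have hO : (fun w : κ → ℝ => (w ⬝ᵥ Sig *ᵥ w) / 2) =O[𝓝 0] fun w => ‖w‖ ^ 2 := by
    simpa only [div_eq_inv_mul] using (dotProduct_mulVec_isBigO Sig).const_mul_left (2 : ℝ)⁻¹
  have ht : Tendsto (fun w : κ → ℝ => ‖w‖ ^ 2) (𝓝 0) (𝓝 0) := by
    have : Continuous fun w : κ → ℝ => ‖w‖ ^ 2 := by fun_prop
    simpa using this.tendsto 0
  have hq := hO.trans_tendsto ht
  have h2 : (fun w : κ → ℝ => Complex.exp (-(((w ⬝ᵥ Sig *ᵥ w) / 2 : ℝ) : ℂ))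
      - (1 - ((w ⬝ᵥ Sig *ᵥ w : ℝ) : ℂ) / 2)) =o[𝓝 0] fun w => ‖w‖ ^ 2 := by
    -- With `q = (w ⬝ᵥ Sig *ᵥ w) / 2`, the error is `O(q²)`; as `q = O(‖w‖²)` and `q → 0`, it is
    -- `o(‖w‖²)`.
    refine Asymptotics.IsBigO.trans_isLittleO
      (g := fun w : κ → ℝ => ((w ⬝ᵥ Sig *ᵥ w) / 2) ^ 2) ?_ ?_
    · refine Asymptotics.IsBigO.of_bound 1 ?_
      filter_upwards [hq.eventually_lt_const one_pos] with w hw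
      have := norm_exp_neg_sub_one_sub_le (hq0 w) hw.le
      rw [one_mul, Real.norm_of_nonneg (by positivity)]
      simpa using this
    · have := hO.mul_isLittleO ((Asymptotics.isLittleO_one_iff ℝ).2 hq)
      simpa only [mul_one, ← sq] using this
  have := (integral_exp_dotProduct_isLittleO hX hmean hcov).sub h2
  simpa using this

end RandomVector

/-- The central limit theorem for weighted sums of iid random vectors, in terms of characteristic
functions. -/
lemma tendsto_charFun_sum_dotProduct {Ω κ : Type*} [MeasurableSpace Ω] [Fintype κ]
    {P : Measure Ω} [IsProbabilityMeasure P] {ε : ℕ → Ω → κ → ℝ} {Sig : Matrix κ κ ℝ}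
    (hindep : iIndepFun ε P) (hident : ∀ j, IdentDistrib (ε j) (ε 0) P P)
    (hL2 : ∀ a, MemLp (fun ω => ε 0 ω a) 2 P) (hmean : ∀ a, ∫ ω, ε 0 ω a ∂P = 0)
    (hcov : ∀ a b, cov[fun ω => ε 0 ω a, fun ω => ε 0 ω b; P] = Sig a b)
    {w : (n : ℕ) → Fin n → κ → ℝ} {C q : ℝ}
    (hsmall : ∀ δ > 0, ∀ᶠ n in atTop, ∀ j, ‖w n j‖ < δ)
    (hbdd : ∀ᶠ n in atTop, ∑ j, ‖w n j‖ ^ 2 ≤ C)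
    (hq : Tendsto (fun n => ∑ j, w n j ⬝ᵥ Sig *ᵥ w n j) atTop (𝓝 q)) :
    Tendsto (fun n => charFun (P.map fun ω => ∑ j : Fin n, w n j ⬝ᵥ ε j ω) 1) atTop
      (𝓝 (Complex.exp (-(q / 2 : ℝ)))) := by
  set φ : (κ → ℝ) → ℂ := fun w => ∫ ω, Complex.exp ((w ⬝ᵥ ε 0 ω : ℝ) * Complex.I) ∂P with hφ
  have hlin (v : κ → ℝ) : Measurable fun y : κ → ℝ => v ⬝ᵥ y := by
    unfold dotProduct
    fun_prop
  have hprod (n : ℕ) :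
      charFun (P.map fun ω => ∑ j : Fin n, w n j ⬝ᵥ ε j ω) 1 = ∏ j, φ (w n j) := by
    have hind : iIndepFun (fun (j : Fin n) ω => w n j ⬝ᵥ ε j ω) P :=
      (hindep.precomp Fin.val_injective).comp (fun j y => w n j ⬝ᵥ y) fun j => hlin _
    have hm (j : Fin n) : AEMeasurable (fun ω => w n j ⬝ᵥ ε j ω) P :=
      (hlin (w n j)).comp_aemeasurable (hident j).aemeasurable_fst
    rw [hind.charFun_map_fun_sum_eq_prod hm, Finset.prod_apply]
    refine Finset.prod_congr rfl fun j _ => ?_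
    have hid := ((hident j).comp (hlin (w n j))).map_eq
    simp only [Function.comp_def] at hid
    have hm0 : AEMeasurable (fun ω => w n j ⬝ᵥ ε 0 ω) P :=
      (hlin (w n j)).comp_aemeasurable (hident 0).aemeasurable_fst
    rw [hid, charFun_apply_real, integral_map hm0 (by fun_prop)]
    simp [hφ]
  simp_rw [hprod]
  have hpsd := posSemidef_of_covariance_eq hL2 hcov
  set γ : (κ → ℝ) → ℂ := fun w => Complex.exp (-(((w ⬝ᵥ Sig *ᵥ w) / 2 : ℝ) : ℂ)) with hγ
  have hγprod : Tendsto (fun n => ∏ j, γ (w n j)) atTop (𝓝 (Complex.exp (-(q / 2 : ℝ)))) := by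
    have h1 : Tendsto (fun n => (∑ j, w n j ⬝ᵥ Sig *ᵥ w n j) / 2) atTop (𝓝 (q / 2)) :=
      hq.div_const 2
    have h2 : Continuous fun x : ℝ => Complex.exp (-(x : ℂ)) := by fun_prop
    refine ((h2.tendsto _).comp h1).congr fun n => ?_
    simp only [hγ, Function.comp]
    rw [← Complex.exp_sum, Finset.sum_neg_distrib, Finset.sum_div]
    push_cast
    rfl
  have hφ1 (v : κ → ℝ) : ‖φ v‖ ≤ 1 := by
    refine (norm_integral_le_integral_norm _).trans ?_
    simp_rw [Complex.norm_exp_ofReal_mul_I]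
    simp
  have hγ1 (v : κ → ℝ) : ‖γ v‖ ≤ 1 := by
    have := hpsd.dotProduct_mulVec_nonneg v
    simp only [star_trivial] at this
    simp only [hγ]
    rw [← Complex.ofReal_neg, Complex.norm_exp_ofReal, Real.exp_le_one_iff]
    linarith
  have hdiff : Tendsto (fun n => ∏ j, φ (w n j) - ∏ j, γ (w n j)) atTop (𝓝 0) := by
    rw [Metric.tendsto_nhds]
    intro η hη
    -- Chosen so that `c * (|C| + 1) = η / 2`; the form `|C| + 1` is positive whatever the sign of
    -- `C`.
    set c := η / (2 * (|C| + 1)) with hc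
    have hc0 : 0 < c := by positivity
    have ho := (integral_exp_dotProduct_sub_exp_isLittleO hL2 hmean hcov).def hc0
    obtain ⟨δ, hδ, hball⟩ := Metric.eventually_nhds_iff.1 ho
    filter_upwards [hsmall δ hδ, hbdd] with n hn hnC
    rw [dist_zero_right]
    calc _ ≤ ∑ j, ‖φ (w n j) - γ (w n j)‖ :=
          norm_prod_sub_prod_le_sum _ _ _ (fun j _ => hφ1 _) fun j _ => hγ1 _
      _ ≤ ∑ j, c * ‖w n j‖ ^ 2 := by
        refine Finset.sum_le_sum fun j _ => ?_
        have := hball (y := w n j) (by simpa using hn j)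
        rwa [Real.norm_of_nonneg (by positivity)] at this
      _ = c * ∑ j, ‖w n j‖ ^ 2 := by rw [Finset.mul_sum]
      _ ≤ c * (|C| + 1) := by
        gcongr
        linarith [le_abs_self C]
      _ = η / 2 := by rw [hc]; field_simp
      _ < η := by linarith
  simpa using hdiff.add hγprod

/-! ### Weights of the least squares estimator -/

/-- Comparing consecutive averages, `u n / n = ((n + 1) / n) * avg (n + 1) - avg n → 0`. This
handles late indices `j`, as `j ≤ n`; the early ones are finitely many and are beaten by `δ * n`. -/
lemma eventually_forall_lt_mul_of_tendsto_average {u : ℕ → ℝ} (hu : ∀ j, 0 ≤ u j) {L : ℝ}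
    (h : Tendsto (fun n : ℕ => (n : ℝ)⁻¹ * ∑ j ∈ Finset.range n, u j) atTop (𝓝 L)) {δ : ℝ}
    (hδ : 0 < δ) : ∀ᶠ n : ℕ in atTop, ∀ j < n, u j < δ * n := by
  have h1 : Tendsto (fun n : ℕ => ((n : ℝ) + 1) * (n : ℝ)⁻¹) atTop (𝓝 1) := by
    have : Tendsto (fun n : ℕ => 1 + (n : ℝ)⁻¹) atTop (𝓝 (1 + 0)) :=
      tendsto_const_nhds.add (tendsto_inv_atTop_zero.comp tendsto_natCast_atTop_atTop)
    rw [add_zero] at this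
    refine this.congr' ?_
    filter_upwards [eventually_gt_atTop 0] with n hn
    have : (n : ℝ) ≠ 0 := by positivity
    field_simp
  have h2 : Tendsto (fun n : ℕ => (n : ℝ)⁻¹ * u n) atTop (𝓝 0) := by
    have := (h1.mul ((tendsto_add_atTop_iff_nat 1).2 h)).sub h
    rw [one_mul, sub_self] at this
    refine this.congr fun n => ?_
    rw [Finset.sum_range_succ]
    push_cast
    have : (n : ℝ) + 1 ≠ 0 := by positivity
    field_simp
    ring
  -- The cut is made at `N + 1` rather than `N`, so that late indices are nonzero and division by
  -- `j` is legitimate.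
  obtain ⟨N, hN⟩ := eventually_atTop.1 (h2.eventually_lt_const hδ)
  have hlarge : ∀ᶠ n : ℕ in atTop, ∑ j ∈ Finset.range (N + 1), u j < δ * n :=
    (tendsto_natCast_atTop_atTop.const_mul_atTop hδ).eventually_gt_atTop _
  filter_upwards [hlarge] with n hn j hj
  rcases Nat.lt_or_ge j (N + 1) with hjN | hjN
  · exact (Finset.single_le_sum (fun i _ => hu i) (Finset.mem_range.2 hjN)).trans_lt hn
  · have hj0 : (0 : ℝ) < j := by exact_mod_cast (by omega : 0 < j)
    have hlt := hN j (by omega)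
    rw [inv_mul_lt_iff₀ hj0] at hlt
    have : (j : ℝ) ≤ n := by exact_mod_cast hj.le
    nlinarith

lemma sq_norm_le_dotProduct_self {κ : Type*} [Fintype κ] (v : κ → ℝ) : ‖v‖ ^ 2 ≤ v ⬝ᵥ v := by
  have h : ‖v‖ ≤ √(v ⬝ᵥ v) := by
    refine (pi_norm_le_iff_of_nonneg (Real.sqrt_nonneg _)).2 fun a => Real.le_sqrt_of_sq_le ?_
    rw [Real.norm_eq_abs, sq_abs, sq]
    exact Finset.single_le_sum (f := fun a => v a * v a) (fun a _ => mul_self_nonneg _)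
      (Finset.mem_univ a)
  have h0 : 0 ≤ v ⬝ᵥ v := Finset.sum_nonneg fun a _ => mul_self_nonneg (v a)
  calc ‖v‖ ^ 2 ≤ √(v ⬝ᵥ v) ^ 2 := by gcongr
    _ = _ := Real.sq_sqrt h0

lemma norm_vecMul_le {ι κ : Type*} [Fintype ι] [Fintype κ] (v : ι → ℝ) (M : Matrix ι κ ℝ) :
    ‖v ᵥ* M‖ ≤ ‖v‖ * ∑ b, ∑ a, |M a b| := by
  refine (pi_norm_le_iff_of_nonneg (by positivity)).2 fun b => ?_
  refine (abs_dotProduct_le_norm_mul_sum _ _).trans ?_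
  gcongr
  exact Finset.single_le_sum (f := fun b => ∑ a, |M a b|)
    (fun b _ => Finset.sum_nonneg fun a _ => abs_nonneg _) (Finset.mem_univ b)

/-! ### Normalized Gram matrices and limits of the weights -/

section Design

variable {μ κ : Type*}

/-- The Gram matrix of the design at sample size `n`, divided by `n`. -/
noncomputable def normalizedGram (x : ℕ → μ → ℝ) (n : ℕ) : Matrix μ μ ℝ :=
  (n : ℝ)⁻¹ • ((designMatrix x n)ᵀ * designMatrix x n)

lemma isSymm_normalizedGram (x : ℕ → μ → ℝ) (n : ℕ) :
    (normalizedGram x n)ᵀ = normalizedGram x n := by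
  simp [normalizedGram, Matrix.transpose_mul]

variable [Fintype μ]

/-- Links convergence of the Gram matrices to convergence of the averaged squared row lengths. -/
lemma trace_normalizedGram (x : ℕ → μ → ℝ) (n : ℕ) :
    (normalizedGram x n).trace = (n : ℝ)⁻¹ * ∑ j ∈ Finset.range n, x j ⬝ᵥ x j := by
  rw [normalizedGram, Matrix.trace_smul, smul_eq_mul, Matrix.trace_mul_comm, Finset.sum_range]
  rfl

lemma tendsto_trace_normalizedGram {x : ℕ → μ → ℝ} {R : Matrix μ μ ℝ}
    (hX : Tendsto (normalizedGram x) atTop (𝓝 R)) :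
    Tendsto (fun n : ℕ => (n : ℝ)⁻¹ * ∑ j ∈ Finset.range n, x j ⬝ᵥ x j) atTop (𝓝 R.trace) :=
  (((continuous_id.matrix_trace).tendsto R).comp hX).congr fun n => trace_normalizedGram x n

variable [DecidableEq μ]

lemma inv_normalizedGram {x : ℕ → μ → ℝ} {n : ℕ} (hn : 0 < n)
    (h : IsUnit (normalizedGram x n).det) :
    (normalizedGram x n)⁻¹ = (n : ℝ) • ((designMatrix x n)ᵀ * designMatrix x n)⁻¹ := by
  have hn0 : (n : ℝ) ≠ 0 := by positivity
  have hG : (designMatrix x n)ᵀ * designMatrix x n = (n : ℝ) • normalizedGram x n := by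
    rw [normalizedGram, smul_smul, mul_inv_cancel₀ hn0, one_smul]
  have := Matrix.inv_smul' (normalizedGram x n) (Units.mk0 (n : ℝ) hn0) h
  simp only [Units.smul_def, Units.val_mk0, Units.val_inv_eq_inv_val] at this
  rw [hG, this, smul_smul, mul_inv_cancel₀ hn0, one_smul]

/-- The weights, as rows of a matrix, of the error vectors in the linear functional
`trace (Tᵀ * ·)` of `√n • S * E`. -/
noncomputable def olsWeights (x : ℕ → μ → ℝ) (T : Matrix μ κ ℝ) (n : ℕ) :
    Matrix (Fin n) κ ℝ :=
  √(n : ℝ) • ((olsMatrix (designMatrix x n))ᵀ * T)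

lemma olsWeights_eq {x : ℕ → μ → ℝ} (T : Matrix μ κ ℝ) {n : ℕ} (hn : 0 < n)
    (h : IsUnit (normalizedGram x n).det) :
    olsWeights x T n =
      (√(n : ℝ))⁻¹ • (designMatrix x n * ((normalizedGram x n)⁻¹ * T)) := by
  have hn0 : (0 : ℝ) < n := by positivity
  have hs : √(n : ℝ) = (√(n : ℝ))⁻¹ * n := by
    have := Real.mul_self_sqrt hn0.le
    have h' : √(n : ℝ) ≠ 0 := by positivity
    field_simp
    linarith
  have hsymm : (((designMatrix x n)ᵀ * designMatrix x n)⁻¹)ᵀ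
      = ((designMatrix x n)ᵀ * designMatrix x n)⁻¹ := by
    rw [Matrix.transpose_nonsing_inv, Matrix.transpose_mul, Matrix.transpose_transpose]
  rw [olsWeights, olsMatrix, inv_normalizedGram hn h, Matrix.transpose_mul,
    Matrix.transpose_transpose, hsymm, Matrix.smul_mul, Matrix.mul_smul, smul_smul, ← hs,
    Matrix.mul_assoc]

/-- With `A` the normalized Gram matrix, the two outer factors `A⁻¹` enclose an `A` that cancels one
of them. This is the source of `R⁻¹` in the limiting covariance. -/
lemma transpose_olsWeights_mul {x : ℕ → μ → ℝ} (T : Matrix μ κ ℝ) {n : ℕ} (hn : 0 < n)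
    (h : IsUnit (normalizedGram x n).det) :
    (olsWeights x T n)ᵀ * olsWeights x T n = Tᵀ * (normalizedGram x n)⁻¹ * T := by
  have hs : (√(n : ℝ))⁻¹ * (√(n : ℝ))⁻¹ = (n : ℝ)⁻¹ := by
    rw [← mul_inv, Real.mul_self_sqrt (by positivity)]
  set A := normalizedGram x n with hA
  calc (olsWeights x T n)ᵀ * olsWeights x T n
      = Tᵀ * (A⁻¹)ᵀ * ((n : ℝ)⁻¹ • ((designMatrix x n)ᵀ * designMatrix x n)) * (A⁻¹ * T) := by
        rw [olsWeights_eq T hn h]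
        simp only [Matrix.transpose_smul, Matrix.transpose_mul, Matrix.smul_mul, Matrix.mul_smul,
          smul_smul, hs, Matrix.mul_assoc]
        rfl
    _ = Tᵀ * A⁻¹ * (A * A⁻¹) * T := by
        rw [Matrix.transpose_nonsing_inv, isSymm_normalizedGram, ← normalizedGram]
        simp only [Matrix.mul_assoc, ← hA]
    _ = Tᵀ * A⁻¹ * T := by rw [Matrix.mul_nonsing_inv A h, Matrix.mul_one]

variable [Fintype κ]

lemma sum_dotProduct_mulVec_row {ι : Type*} [Fintype ι] (W : Matrix ι κ ℝ) (Sig : Matrix κ κ ℝ) :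
    ∑ j, W j ⬝ᵥ Sig *ᵥ W j = (Sig * (Wᵀ * W)).trace := by
  rw [← Matrix.mul_assoc, Matrix.trace_mul_comm, Matrix.trace]
  rfl

variable {x : ℕ → μ → ℝ} {R : Matrix μ μ ℝ}

lemma tendsto_inv_normalizedGram (hR : R.PosDef)
    (hX : Tendsto (normalizedGram x) atTop (𝓝 R)) :
    Tendsto (fun n => (normalizedGram x n)⁻¹) atTop (𝓝 R⁻¹) := by
  refine (continuousAt_matrix_inv R ?_).tendsto.comp hX
  rw [Ring.inverse_eq_inv']
  exact continuousAt_inv₀ hR.det_pos.ne'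

/-- The determinants converge to `R.det > 0`. For the finitely many other `n`, the value of
`olsMatrix` is irrelevant to the limit. -/
lemma eventually_isUnit_det_normalizedGram (hR : R.PosDef)
    (hX : Tendsto (normalizedGram x) atTop (𝓝 R)) :
    ∀ᶠ n in atTop, 0 < n ∧ IsUnit (normalizedGram x n).det := by
  have hdet : Tendsto (fun n => (normalizedGram x n).det) atTop (𝓝 R.det) :=
    ((continuous_id.matrix_det).tendsto R).comp hX
  filter_upwards [eventually_gt_atTop 0, hdet.eventually_ne hR.det_pos.ne'] with n hn h
  exact ⟨hn, h.isUnit⟩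

lemma exists_eventually_sq_norm_olsWeights_le (hR : R.PosDef)
    (hX : Tendsto (normalizedGram x) atTop (𝓝 R)) (T : Matrix μ κ ℝ) :
    ∃ K > 0, ∀ᶠ n : ℕ in atTop, ∀ j : Fin n,
      ‖olsWeights x T n j‖ ^ 2 ≤ K * ((n : ℝ)⁻¹ * (x j ⬝ᵥ x j)) := by
  set f : Matrix μ μ ℝ → ℝ := fun B => ∑ b, ∑ a, |(B * T) a b| with hf
  have hfc : Continuous f := by
    refine continuous_finsetSum _ fun b _ => continuous_finsetSum _ fun a _ => ?_
    exact ((continuous_id.matrix_mul continuous_const).matrix_elem a b).abs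
  have hlim := (hfc.tendsto _).comp (tendsto_inv_normalizedGram hR hX)
  have hf0 (B : Matrix μ μ ℝ) : 0 ≤ f B := by positivity
  -- `f` bounds the effect of `B * T` on row vectors; by continuity its value at the inverse Gram
  -- matrix is eventually below `f R⁻¹ + 1`.
  refine ⟨(f R⁻¹ + 1) ^ 2, by have := hf0 R⁻¹; positivity, ?_⟩
  filter_upwards [hlim.eventually_lt_const (lt_add_one _),
    eventually_isUnit_det_normalizedGram hR hX] with n hn ⟨hn0, hu⟩ j
  have hrow : olsWeights x T n j = (√(n : ℝ))⁻¹ • (x j ᵥ* ((normalizedGram x n)⁻¹ * T)) := by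
    rw [olsWeights_eq T hn0 hu]
    rfl
  have h1 : ‖x j ᵥ* ((normalizedGram x n)⁻¹ * T)‖ ≤ ‖x j‖ * (f R⁻¹ + 1) :=
    (norm_vecMul_le _ _).trans (mul_le_mul_of_nonneg_left hn.le (norm_nonneg _))
  rw [hrow, norm_smul, mul_pow, Real.norm_of_nonneg (by positivity), inv_pow,
    Real.sq_sqrt (by positivity)]
  calc (n : ℝ)⁻¹ * ‖x j ᵥ* ((normalizedGram x n)⁻¹ * T)‖ ^ 2
      ≤ (n : ℝ)⁻¹ * (‖x j‖ * (f R⁻¹ + 1)) ^ 2 := by gcongr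
    _ = (f R⁻¹ + 1) ^ 2 * ((n : ℝ)⁻¹ * ‖x j‖ ^ 2) := by ring
    _ ≤ _ := by gcongr; exact sq_norm_le_dotProduct_self _

lemma eventually_norm_olsWeights_lt (hR : R.PosDef)
    (hX : Tendsto (normalizedGram x) atTop (𝓝 R)) (T : Matrix μ κ ℝ) {δ : ℝ} (hδ : 0 < δ) :
    ∀ᶠ n in atTop, ∀ j, ‖olsWeights x T n j‖ < δ := by
  obtain ⟨K, hK, hle⟩ := exists_eventually_sq_norm_olsWeights_le hR hX T
  -- The threshold `δ ^ 2 / K` makes the bound `K * (n⁻¹ * (δ ^ 2 / K * n))` equal to `δ ^ 2`.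
  have hsm := eventually_forall_lt_mul_of_tendsto_average (u := fun j => x j ⬝ᵥ x j)
    (fun j => Finset.sum_nonneg fun a _ => mul_self_nonneg _)
    (tendsto_trace_normalizedGram hX) (δ := δ ^ 2 / K) (by positivity)
  filter_upwards [hle, hsm, eventually_gt_atTop 0] with n h1 h2 hn j
  have hn0 : (0 : ℝ) < n := by positivity
  refine lt_of_pow_lt_pow_left₀ 2 hδ.le ((h1 j).trans_lt ?_)
  have := h2 j j.2
  calc K * ((n : ℝ)⁻¹ * (x j ⬝ᵥ x j)) < K * ((n : ℝ)⁻¹ * (δ ^ 2 / K * n)) := by gcongr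
    _ = δ ^ 2 := by field_simp

lemma exists_eventually_sum_sq_norm_olsWeights_le (hR : R.PosDef)
    (hX : Tendsto (normalizedGram x) atTop (𝓝 R)) (T : Matrix μ κ ℝ) :
    ∃ C, ∀ᶠ n in atTop, ∑ j, ‖olsWeights x T n j‖ ^ 2 ≤ C := by
  obtain ⟨K, hK, hle⟩ := exists_eventually_sq_norm_olsWeights_le hR hX T
  refine ⟨K * (R.trace + 1), ?_⟩
  filter_upwards [hle, (tendsto_trace_normalizedGram hX).eventually_lt_const (lt_add_one _)]
    with n h1 h2
  calc _ ≤ ∑ j : Fin n, K * ((n : ℝ)⁻¹ * (x j ⬝ᵥ x j)) := Finset.sum_le_sum fun j _ => h1 j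
    _ = K * ((n : ℝ)⁻¹ * ∑ j ∈ Finset.range n, x j ⬝ᵥ x j) := by
      rw [Finset.sum_range, Finset.mul_sum, Finset.mul_sum]
    _ ≤ _ := by gcongr

lemma tendsto_sum_olsWeights_quadraticForm (hR : R.PosDef)
    (hX : Tendsto (normalizedGram x) atTop (𝓝 R)) (T : Matrix μ κ ℝ) (Sig : Matrix κ κ ℝ) :
    Tendsto (fun n => ∑ j, olsWeights x T n j ⬝ᵥ Sig *ᵥ olsWeights x T n j) atTop
      (𝓝 (Sig * (Tᵀ * R⁻¹ * T)).trace) := by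
  have hc : Continuous fun B : Matrix μ μ ℝ => (Sig * (Tᵀ * B * T)).trace := by fun_prop
  refine ((hc.tendsto _).comp (tendsto_inv_normalizedGram hR hX)).congr' ?_
  filter_upwards [eventually_isUnit_det_normalizedGram hR hX] with n ⟨hn, hu⟩
  rw [sum_dotProduct_mulVec_row, transpose_olsWeights_mul T hn hu]
  rfl

end Design

/-! ### Asymptotic normality -/

section Normal

variable {μ κ : Type*}

lemma continuous_unRowVec : Continuous (unRowVec : EuclideanSpace ℝ (μ × κ) → Matrix μ κ ℝ) := by
  refine continuous_pi fun i => continuous_pi fun a => ?_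
  change Continuous fun v : EuclideanSpace ℝ (μ × κ) => v (i, a)
  fun_prop

lemma measurable_rowVec : Measurable (rowVec : Matrix μ κ ℝ → EuclideanSpace ℝ (μ × κ)) := by
  refine (WithLp.measurable_toLp 2 _).comp (measurable_pi_lambda _ fun q => ?_)
  exact (measurable_pi_apply q.2).comp (measurable_pi_apply q.1)

variable [Fintype μ] [Fintype κ]

lemma dotProduct_kronecker_mulVec_rowVec {A : Matrix μ μ ℝ} (hA : Aᵀ = A)
    (B : Matrix κ κ ℝ) (t : EuclideanSpace ℝ (μ × κ)) :
    t.ofLp ⬝ᵥ (A ⊗ₖ B) *ᵥ t.ofLp = (B * ((unRowVec t)ᵀ * A * unRowVec t)).trace := by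
  -- `Matrix.vec` stacks columns, so row stacking is `Matrix.vec` of the transpose.
  have ht : t.ofLp = Matrix.vec (unRowVec t)ᵀ := rfl
  rw [ht, Matrix.kronecker_mulVec_vec, Matrix.vec_dotProduct_vec, Matrix.transpose_transpose, hA,
    Matrix.trace_mul_comm]
  simp only [Matrix.mul_assoc]

variable [DecidableEq μ]

/-- The Euclidean inner product of row stackings is the trace pairing of matrices, under which left
multiplication by `S` has adjoint left multiplication by `Sᵀ`. -/
lemma inner_rowVec_olsMatrix_mul (x : ℕ → μ → ℝ) (n : ℕ) (E : Matrix (Fin n) κ ℝ)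
    (t : EuclideanSpace ℝ (μ × κ)) :
    inner ℝ (rowVec (√(n : ℝ) • (olsMatrix (designMatrix x n) * E))) t
      = ∑ j, olsWeights x (unRowVec t) n j ⬝ᵥ E j := by
  set M := √(n : ℝ) • (olsMatrix (designMatrix x n) * E) with hM
  have h1 : inner ℝ (rowVec M) t = (M * (unRowVec t)ᵀ).trace := by
    rw [PiLp.inner_apply, Fintype.sum_prod_type, Matrix.trace]
    refine Finset.sum_congr rfl fun a _ => Finset.sum_congr rfl fun b _ => ?_
    simp [rowVec, unRowVec, mul_comm]
  have h2 : ∑ j, olsWeights x (unRowVec t) n j ⬝ᵥ E j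
      = (olsWeights x (unRowVec t) n * Eᵀ).trace := rfl
  rw [h1, h2, ← Matrix.trace_transpose (M * _), hM, olsWeights]
  simp only [Matrix.transpose_mul, Matrix.transpose_smul, Matrix.transpose_transpose,
    Matrix.smul_mul, Matrix.trace_smul]
  rw [← Matrix.mul_assoc, Matrix.trace_mul_comm, Matrix.mul_assoc, Matrix.trace_mul_comm]

/-- **Asymptotic normality of the least squares estimator** in the multivariate linear model. -/
theorem tendstoInDistribution_sqrt_smul_olsMatrix_mul [DecidableEq κ]
    {Ω : Type*} [MeasurableSpace Ω] {P : Measure Ω} [IsProbabilityMeasure P]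
    {x : ℕ → μ → ℝ} {R : Matrix μ μ ℝ} (hR : R.PosDef)
    (hX : Tendsto (normalizedGram x) atTop (𝓝 R))
    {ε : ℕ → Ω → κ → ℝ} {Sig : Matrix κ κ ℝ}
    (hindep : iIndepFun ε P) (hident : ∀ j, IdentDistrib (ε j) (ε 0) P P)
    (hL2 : ∀ a, MemLp (fun ω => ε 0 ω a) 2 P) (hmean : ∀ a, ∫ ω, ε 0 ω a ∂P = 0)
    (hcov : ∀ a b, cov[fun ω => ε 0 ω a, fun ω => ε 0 ω b; P] = Sig a b) :
    TendstoInDistribution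
      (fun (n : ℕ) (ω : Ω) => √(n : ℝ) • (olsMatrix (designMatrix x n) * errorMatrix ε n ω))
      atTop id (fun _ => P) (matrixNormal 0 (R⁻¹ ⊗ₖ Sig)) := by
  set M : (n : ℕ) → Ω → Matrix μ κ ℝ :=
    fun n ω => √(n : ℝ) • (olsMatrix (designMatrix x n) * errorMatrix ε n ω) with hM
  have hMm (n : ℕ) : AEMeasurable (M n) P := by
    refine aemeasurable_pi_iff.2 fun a => aemeasurable_pi_iff.2 fun b => ?_
    change AEMeasurable (fun ω => √(n : ℝ) *
      ∑ j : Fin n, olsMatrix (designMatrix x n) a j * ε j ω b) P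
    have (j : ℕ) : AEMeasurable (fun ω => ε j ω b) P :=
      aemeasurable_pi_iff.1 (hident j).aemeasurable_fst b
    fun_prop
  have hVm (n : ℕ) : AEMeasurable (fun ω => rowVec (M n ω)) P :=
    measurable_rowVec.comp_aemeasurable (hMm n)
  have hpsd : (R⁻¹ ⊗ₖ Sig).PosSemidef :=
    hR.inv.posSemidef.kronecker (posSemidef_of_covariance_eq hL2 hcov)
  have hRs : (R⁻¹)ᵀ = R⁻¹ := by
    rw [Matrix.transpose_nonsing_inv, ← Matrix.conjTranspose_eq_transpose_of_trivial,
      hR.isHermitian.eq]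
  have hvec : TendstoInDistribution (fun n ω => rowVec (M n ω)) atTop id (fun _ => P)
      (multivariateGaussian (rowVec 0) (R⁻¹ ⊗ₖ Sig)) := by
    refine ⟨hVm, aemeasurable_id, ProbabilityMeasure.tendsto_iff_tendsto_charFun.2 fun t => ?_⟩
    have h0 : rowVec (0 : Matrix μ κ ℝ) = 0 := rfl
    obtain ⟨C, hC⟩ := exists_eventually_sum_sq_norm_olsWeights_le hR hX (unRowVec t)
    have key := tendsto_charFun_sum_dotProduct hindep hident hL2 hmean hcov
      (fun δ hδ => eventually_norm_olsWeights_lt hR hX (unRowVec t) hδ) hC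
      (tendsto_sum_olsWeights_quadraticForm hR hX (unRowVec t) Sig)
    simp only [ProbabilityMeasure.coe_mk, Measure.map_id]
    rw [charFun_multivariateGaussian hpsd, h0, inner_zero_right,
      dotProduct_kronecker_mulVec_rowVec hRs]
    refine (key.congr fun n => ?_).trans (le_of_eq ?_)
    -- Cramér–Wold: the characteristic function of a vector at `t` is that of its scalar projection
    -- along `t` at `1`.
    · have hs : (fun ω => ∑ j : Fin n, olsWeights x (unRowVec t) n j ⬝ᵥ ε j ω)
          = fun ω => inner ℝ (rowVec (M n ω)) t := by
        ext ω
        exact (inner_rowVec_olsMatrix_mul x n (errorMatrix ε n ω) t).symm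
      have hi : AEMeasurable (fun ω => inner ℝ (rowVec (M n ω)) t) P :=
        (continuous_id.inner continuous_const).measurable.comp_aemeasurable (hVm n)
      rw [hs, charFun_apply_real, charFun_apply, integral_map (hVm n) (by fun_prop),
        integral_map hi (by fun_prop)]
      simp
    · congr 2
      push_cast
      ring
  -- The continuous mapping theorem returns from row-stacked vectors to matrices.
  have hmat := hvec.continuous_comp continuous_unRowVec
  refine ⟨hMm, aemeasurable_id, ?_⟩
  convert! hmat.tendsto using 3
  simp [matrixNormal]

end Normal

theorem theorem4p1
    {Ω : Type*} [MeasurableSpace Ω] (P : Measure Ω) [IsProbabilityMeasure P]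
    (k p : ℕ) (m : Fin k → ℕ)
    -- the design matrices, given by their rows, and the limits of the normalized Gram matrices
    (x : (i : Fin k) → ℕ → Fin (m i) → ℝ)
    (R : (i : Fin k) → Matrix (Fin (m i)) (Fin (m i)) ℝ)
    (hR : ∀ l, (R l).PosDef)
    (hX : ∀ l, Tendsto
      (fun n : ℕ => (n : ℝ)⁻¹ • ((designMatrix (x l) n)ᵀ * designMatrix (x l) n))
      atTop (𝓝 (R l)))
    -- the rows of the error matrix: iid, centred, square integrable, with covariance matrix `Sig`
    (ε : ℕ → Ω → Fin p → ℝ) (Sig : Matrix (Fin p) (Fin p) ℝ)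
    (hindep : iIndepFun ε P)
    (hident : ∀ j, IdentDistrib (ε j) (ε 0) P P)
    (hL2 : ∀ a, MemLp (fun ω => ε 0 ω a) 2 P)
    (hmean : ∀ a, ∫ ω, ε 0 ω a ∂P = 0)
    (hcov : ∀ a b, cov[fun ω => ε 0 ω a, fun ω => ε 0 ω b; P] = Sig a b)
    (i : Fin k) :
    TendstoInDistribution
      (fun (n : ℕ) (ω : Ω) =>
        √(n : ℝ) • (olsMatrix (designMatrix (x i) n) * errorMatrix ε n ω))
      atTop id (fun _ => P) (matrixNormal 0 ((R i)⁻¹ ⊗ₖ Sig)) :=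
  tendstoInDistribution_sqrt_smul_olsMatrix_mul (hR i) (hX i) hindep hident hL2 hmean hcov
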